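/- Let $\mathcal P(\mathcal X)$ be the set of probability measures with finite first moment on $\mathcal X$, and let $\mu,\nu\in\mathcal P(\mathbb R)$ be in convex order: $\int f\,d\mu\le\int f\,d\nu$ for every convex $f:\mathbb R\to\mathbb R$. Let $\mathcal M(\mu,\nu)$ be the set of laws $\pi\in\mathcal P(\mathbb R^2)$ of pairs $(X,Y)$ with $X\sim\mu$, $Y\sim\nu$ and $\mathbb E_\pi[Y\mid X]=X$. Let $c_1:\mathbb R\to\mathbb R$, $c_1=c_1(x)$, and $c_2:\mathbb R^2\to\mathbb R$, $c_2=c_2(x,y)$, be continuous, and assume that there are continuous $v\in L^1(\mu)$, $w\in L^1(\nu)$ with $|c_1(x)|+|c_2(x,y)|\le v(x)+w(y)$ for all $x,y\in\mathbb R$. For $\pi\in\mathcal M(\mu,\nu)$ with disintegration $\pi=\pi_x\otimes\mu$ and a nonnegative measure $\mu_1\le\mu$, put $\mu_2=\mu-\mu_1$ and $\gamma_l=\pi_x\otimes\mu_l$ for $l=1,2$, and define $$P_c=\sup_{\pi\in\mathcal M(\mu,\nu)}\ \sup_{\mu_1\le\mu}\ \Big(\int c_1(x)\,d\gamma_1+\int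 c_2(x,y)\,d\gamma_2\Big).$$ A pair $(\pi,\mu_1)$ with $\pi\in\mathcal M(\mu,\nu)$ and $\mu_1\le\mu$ that attains this supremum is called optimal. Let $\overline{\mathcal M}$ be the set of finite measures $\gamma\ge 0$ on $\mathbb R^2$ such that $\gamma=0$ or $\gamma/\gamma(\mathbb R^2)\in\mathcal M(\mu',\nu')$ for some $\mu',\nu'\in\mathcal P(\mathbb R)$ in convex order, and define the relaxed value $$\overline P_c=\sup\Big\{\int c_1(x)\,d\gamma_1+\int c_2(x,y)\,d\gamma_2\ :\ \gamma_1,\gamma_2\in\overline{\mathcal M},\ \gamma_1+\gamma_2\in\mathcal M(\mu,\nu)\Big\}.$$ Suppose that for $\mu$-a.e. $x$ the function $y\mapsto c_2(x,y)$ is strictly convex on $\mathbb R$ and $c_1(x)\ne c_2(x,x)$, that $\nu$ is absolutely continuous with respect to Lebesgue measure, and that $P_c=\overline P_c$. Then every optimal pair $(\pi,\mu_1)$ satisfies $\mu_1\perp\mu-\mu_1$. Furthermore, for each $\pi$ there is at most one $\mu_1$ such that $(\pi,\mu_1)$ is optimal. -/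

import Mathlib

open MeasureTheory ProbabilityTheory
open scoped ENNReal

noncomputable section

namespace AmericanOption

/-- `m` is a probability measure with finite first moment. -/
def FiniteMomentProb {E : Type*} [NormedAddCommGroup E] [MeasurableSpace E]
    (m : Measure E) : Prop :=
  IsProbabilityMeasure m ∧ Integrable (fun x : E => ‖x‖) m

/-- Convex order of two probability measures on `ℝ` with finite first moment: `μ(f) ≤ ν(f)` for
every convex `f`. Such an `f` dominates an affine function, so both integrals are well defined in
`(-∞, ∞]`; the inequality is void if `ν(f) = ∞`, and otherwise says that `μ(f)` is finite too and
at most `ν(f)`. -/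
def ConvexOrder (μ ν : Measure ℝ) : Prop :=
  ∀ f : ℝ → ℝ, ConvexOn ℝ Set.univ f → Integrable f ν →
    Integrable f μ ∧ ∫ x, f x ∂μ ≤ ∫ y, f y ∂ν

/-- The set `M(μ, ν)` of martingale transports: laws `π` on `ℝ × ℝ` (with finite first moment) of a
pair `(X, Y)` with `X ∼ μ`, `Y ∼ ν` and `E[Y | X] = X`. -/
def martingaleTransports (μ ν : Measure ℝ) : Set (Measure (ℝ × ℝ)) :=
  {π | FiniteMomentProb π ∧ π.map Prod.fst = μ ∧ π.map Prod.snd = ν ∧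
    π[(Prod.snd : ℝ × ℝ → ℝ) | MeasurableSpace.comap (Prod.fst : ℝ × ℝ → ℝ) inferInstance]
      =ᵐ[π] (Prod.fst : ℝ × ℝ → ℝ)}

/-- All martingale transports between some two marginals in convex order. -/
def allMartingaleTransports : Set (Measure (ℝ × ℝ)) :=
  {π | ∃ μ ν : Measure ℝ, FiniteMomentProb μ ∧ FiniteMomentProb ν ∧ ConvexOrder μ ν ∧
    π ∈ martingaleTransports μ ν}

/-- Martingale transports of arbitrary finite total mass. -/
def finiteMartingaleTransports : Set (Measure (ℝ × ℝ)) :=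
  {γ | γ = 0 ∨ (γ Set.univ ≠ 0 ∧ γ Set.univ ≠ ∞ ∧
    (γ Set.univ)⁻¹ • γ ∈ allMartingaleTransports)}

/-- `E_{γ₁}[c₁(X)] + E_{γ₂}[c₂(X, Y)]`. -/
def pairPayoff (c₁ : ℝ → ℝ) (c₂ : ℝ → ℝ → ℝ) (γ₁ γ₂ : Measure (ℝ × ℝ)) : ℝ :=
  (∫ p, c₁ p.1 ∂γ₁) + (∫ p, c₂ p.1 p.2 ∂γ₂)

/-- The expected payoff of the model `π` with exercise scheme `μ₁`, that is, the payoff of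
`γ₁ = π_x ⊗ μ₁` and `γ₂ = π_x ⊗ (μ - μ₁)`, where `π_x` is the disintegration kernel of `π` with
respect to its first marginal. -/
def payoff (c₁ : ℝ → ℝ) (c₂ : ℝ → ℝ → ℝ) (μ : Measure ℝ)
    (π : ProbabilityMeasure (ℝ × ℝ)) (μ₁ : Measure ℝ) : ℝ :=
  pairPayoff c₁ c₂ (μ₁ ⊗ₘ (π : Measure (ℝ × ℝ)).condKernel)
    ((μ - μ₁) ⊗ₘ (π : Measure (ℝ × ℝ)).condKernel)

/-- The value `P_c`. -/
def value (c₁ : ℝ → ℝ) (c₂ : ℝ → ℝ → ℝ) (μ ν : Measure ℝ) : EReal :=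
  ⨆ (π : ProbabilityMeasure (ℝ × ℝ)) (_ : (π : Measure (ℝ × ℝ)) ∈ martingaleTransports μ ν)
    (μ₁ : Measure ℝ) (_ : μ₁ ≤ μ), ((payoff c₁ c₂ μ π μ₁ : ℝ) : EReal)

/-- The relaxed value: `γ₁`, `γ₂` are martingale transports of finite mass whose sum
lies in `M(μ, ν)`, but they need not share a kernel. -/
def relaxedValue (c₁ : ℝ → ℝ) (c₂ : ℝ → ℝ → ℝ) (μ ν : Measure ℝ) : EReal :=
  ⨆ (γ₁ : Measure (ℝ × ℝ)) (γ₂ : Measure (ℝ × ℝ))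
    (_ : γ₁ ∈ finiteMartingaleTransports) (_ : γ₂ ∈ finiteMartingaleTransports)
    (_ : γ₁ + γ₂ ∈ martingaleTransports μ ν), ((pairPayoff c₁ c₂ γ₁ γ₂ : ℝ) : EReal)

/-- `(π, μ₁)` is a solution of the problem defining `value`: it is admissible and attains `P_c`. -/
def IsOptimalPair (c₁ : ℝ → ℝ) (c₂ : ℝ → ℝ → ℝ) (μ ν : Measure ℝ)
    (π : ProbabilityMeasure (ℝ × ℝ)) (μ₁ : Measure ℝ) : Prop :=
  (π : Measure (ℝ × ℝ)) ∈ martingaleTransports μ ν ∧ μ₁ ≤ μ ∧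
    ((payoff c₁ c₂ μ π μ₁ : ℝ) : EReal) = value c₁ c₂ μ ν

end AmericanOption

end

/-!
Suppose that an optimal `μ₁` and `μ - μ₁` had a common part `ρ ≠ 0`, and let `κ` be the kernel of
`π`, so that `ρ ⊗ κ` lies below both `γ₁` and `γ₂`. Draw `x ∼ ρ` and `y, y' ∼ κ x`, and
independently `(x', z) ∼ ρ ⊗ κ`. If `z` lies strictly between `y` and `y'`, then the mass that
`γ₁` transports from `x` to `y` and `y'`, weighted so that its barycentre is `z`, can be exchanged
with the mass that `γ₂` transports from `x'` to `z`. This preserves the two martingale conditions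
and the marginals of `γ₁ + γ₂`, but by strict convexity of `c₂ x'` it increases the payoff, so
that `value` would be smaller than `relaxedValue`. Hence almost surely no mass of the second
marginal of `ρ ⊗ κ` lies between `y` and `y'`. As that marginal has no atoms, `y = y'` almost
surely, so `κ x` is a Dirac mass, which the martingale condition puts at `x`. On the diagonal,
mass can be moved between `γ₁` and `γ₂` in both directions, which forces `c₁ x = c₂ x x` for
`ρ`-almost every `x`, against the hypothesis.

The payoff is affine in `μ₁`, so the midpoint of two optimal choices `μ₁` and `μ₁'` is optimal too,
and its singularity to the midpoint of `μ - μ₁` and `μ - μ₁'` leaves room only for `μ₁ = μ₁'`.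
-/

namespace AmericanOption

section CompProd

variable {α β : Type*} [MeasurableSpace α] [MeasurableSpace β] {μ ρ : Measure α}
  {κ : Kernel α β}

lemma compProd_mono_left [SFinite μ] [SFinite ρ] [IsSFiniteKernel κ] (h : ρ ≤ μ) :
    ρ ⊗ₘ κ ≤ μ ⊗ₘ κ := by
  refine Measure.le_iff.mpr fun s hs => ?_
  rw [Measure.compProd_apply hs, Measure.compProd_apply hs]
  exact lintegral_mono' h le_rfl

lemma integrable_integral_compProd [SFinite μ] [IsSFiniteKernel κ] {E : Type*}
    [NormedAddCommGroup E] [NormedSpace ℝ E] {f : α × β → E} (hf : Integrable f (μ ⊗ₘ κ)) :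
    Integrable (fun x => ∫ y, f (x, y) ∂κ x) μ := by
  simpa only [Kernel.const_apply, Kernel.prodMkLeft_apply] using
    Integrable.integral_compProd (κ := Kernel.const Unit μ) (η := Kernel.prodMkLeft Unit κ)
      (a := ()) hf

lemma map_compProd_prod_left [SFinite μ] [IsSFiniteKernel κ] {γ : Type*} [MeasurableSpace γ]
    (η : Kernel α γ) [IsMarkovKernel η] :
    (μ ⊗ₘ (κ ×ₖ η)).map (fun p => (p.1, p.2.1)) = μ ⊗ₘ κ := by
  have h := Measure.compProd_map (μ := μ) (κ := κ ×ₖ η) measurable_fst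
  rw [← Kernel.fst_eq, Kernel.fst_prod] at h
  exact h.symm

lemma measurePreserving_prodMap_swap [SFinite μ] [IsSFiniteKernel κ] :
    MeasurePreserving (Prod.map id Prod.swap) (μ ⊗ₘ (κ ×ₖ κ)) (μ ⊗ₘ (κ ×ₖ κ)) := by
  refine ⟨by fun_prop, ?_⟩
  rw [← Measure.compProd_map measurable_swap, Kernel.map_prod_swap]

lemma ae_compProd_fst_of_ae [SFinite μ] [IsMarkovKernel κ] {p : α → Prop} (h : ∀ᵐ x ∂μ, p x) :
    ∀ᵐ q ∂(μ ⊗ₘ κ), p q.1 := by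
  rw [← Measure.fst_compProd μ κ] at h
  exact ae_of_ae_map measurable_fst.aemeasurable h

end CompProd

section Marginals

variable {α β : Type*} [MeasurableSpace α] [MeasurableSpace β] {μ : Measure α} {ν : Measure β}
  {σ τ : Measure (α × β)}

/-- The marginals of `τ` are at most `μ` and `ν`. -/
structure HasSubmarginals (τ : Measure (α × β)) (μ : Measure α) (ν : Measure β) : Prop where
  fst_le : τ.fst ≤ μ
  snd_le : τ.snd ≤ ν

namespace HasSubmarginals

lemma mono (h : HasSubmarginals τ μ ν) (hσ : σ ≤ τ) : HasSubmarginals σ μ ν :=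
  ⟨(Measure.map_mono hσ measurable_fst).trans h.fst_le,
    (Measure.map_mono hσ measurable_snd).trans h.snd_le⟩

lemma isFiniteMeasure [IsFiniteMeasure μ] (h : HasSubmarginals τ μ ν) : IsFiniteMeasure τ :=
  ⟨Measure.fst_univ (ρ := τ) ▸ (h.fst_le Set.univ).trans_lt (measure_lt_top μ Set.univ)⟩

variable {E : Type*} [NormedAddCommGroup E]

lemma integrable_comp_fst (h : HasSubmarginals τ μ ν) {f : α → E} (hf : Integrable f μ) :
    Integrable (fun p => f p.1) τ :=
  (hf.mono_measure h.fst_le).comp_measurable measurable_fst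

lemma integrable_comp_snd (h : HasSubmarginals τ μ ν) {f : β → E} (hf : Integrable f ν) :
    Integrable (fun p => f p.2) τ :=
  (hf.mono_measure h.snd_le).comp_measurable measurable_snd

end HasSubmarginals

end Marginals

lemma hasSubmarginals_map_iff {Ω α β : Type*} [MeasurableSpace Ω] [MeasurableSpace α]
    [MeasurableSpace β] {τ : Measure Ω} {μ : Measure α} {ν : Measure β} {X : Ω → α} {Y : Ω → β}
    (hX : Measurable X) (hY : Measurable Y) :
    HasSubmarginals (τ.map fun ω => (X ω, Y ω)) μ ν ↔ τ.map X ≤ μ ∧ τ.map Y ≤ ν := by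
  rw [← Measure.fst_map_prodMk (X := X) hY, ← Measure.snd_map_prodMk (Y := Y) hX]
  exact ⟨fun h => ⟨h.fst_le, h.snd_le⟩, fun h => ⟨h.1, h.2⟩⟩

/-- The net displacement from `X` to `Y` of the part of the transport `γ` that starts in `S`,
where `(X, Y)` denotes the identity of `ℝ × ℝ`. A coupling is a martingale coupling if its drift
vanishes on every measurable set. -/
noncomputable def drift (γ : Measure (ℝ × ℝ)) (S : Set ℝ) : ℝ :=
  ∫ p in Prod.fst ⁻¹' S, (p.2 - p.1) ∂γ

section Drift

variable {γ γ' : Measure (ℝ × ℝ)}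

lemma integrable_snd_sub_fst (h : Integrable id γ) :
    Integrable (fun p : ℝ × ℝ => p.2 - p.1) γ :=
  h.snd.sub h.fst

lemma drift_add (h : Integrable id γ) (h' : Integrable id γ') (S : Set ℝ) :
    drift (γ + γ') S = drift γ S + drift γ' S := by
  rw [drift, Measure.restrict_add,
    integral_add_measure (integrable_snd_sub_fst h).integrableOn
      (integrable_snd_sub_fst h').integrableOn]
  rfl

lemma drift_eq_sub (h : Integrable id γ) (S : Set ℝ) :
    drift γ S = ∫ p in Prod.fst ⁻¹' S, p.2 ∂γ - ∫ p in Prod.fst ⁻¹' S, p.1 ∂γ :=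
  integral_sub h.snd.integrableOn h.fst.integrableOn

lemma drift_map {Ω : Type*} [MeasurableSpace Ω] {τ : Measure Ω} {X Y : Ω → ℝ}
    (hX : Measurable X) (hY : Measurable Y) {S : Set ℝ} (hS : MeasurableSet S) :
    drift (τ.map fun ω => (X ω, Y ω)) S = ∫ ω in X ⁻¹' S, (Y ω - X ω) ∂τ :=
  setIntegral_map (measurable_fst hS) (by fun_prop) (hX.prodMk hY).aemeasurable

lemma drift_compProd {μ : Measure ℝ} {κ : Kernel ℝ ℝ} [SFinite μ] [IsSFiniteKernel κ]
    (h : Integrable id (μ ⊗ₘ κ)) {S : Set ℝ} (hS : MeasurableSet S) :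
    drift (μ ⊗ₘ κ) S = ∫ x in S, ∫ y, (y - x) ∂κ x ∂μ := by
  rw [drift, ← Set.prod_univ,
    Measure.setIntegral_compProd hS .univ (integrable_snd_sub_fst h).integrableOn]
  simp only [Measure.restrict_univ]

end Drift

/-- Finite measures on `ℝ × ℝ` with a finite first moment under which the second coordinate has
conditional mean equal to the first one. For probability measures these are the martingale
transports between their own marginals. -/
structure IsMartingaleCoupling (γ : Measure (ℝ × ℝ)) : Prop where
  isFiniteMeasure : IsFiniteMeasure γ
  integrable_id : Integrable id γ
  drift_eq_zero : ∀ S : Set ℝ, MeasurableSet S → drift γ S = 0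

namespace IsMartingaleCoupling

section Operations

variable {γ γ' m m' : Measure (ℝ × ℝ)}

lemma add (h : IsMartingaleCoupling γ) (h' : IsMartingaleCoupling γ') :
    IsMartingaleCoupling (γ + γ') where
  isFiniteMeasure := have := h.isFiniteMeasure; have := h'.isFiniteMeasure; inferInstance
  integrable_id := h.integrable_id.add_measure h'.integrable_id
  drift_eq_zero S hS := by
    rw [drift_add h.integrable_id h'.integrable_id, h.drift_eq_zero S hS, h'.drift_eq_zero S hS,
      add_zero]

lemma smul (h : IsMartingaleCoupling γ) {c : ℝ≥0∞} (hc : c ≠ ∞) :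
    IsMartingaleCoupling (c • γ) where
  isFiniteMeasure := have := h.isFiniteMeasure; Measure.smul_finite γ hc
  integrable_id := h.integrable_id.smul_measure hc
  drift_eq_zero S hS := by
    rw [drift, Measure.restrict_smul, integral_smul_measure, ← drift, h.drift_eq_zero S hS,
      smul_zero]

lemma exchange (h : IsMartingaleCoupling γ) (hm : m ≤ γ) [IsFiniteMeasure m']
    (hm' : Integrable id m') (hd : ∀ S, MeasurableSet S → drift m' S = drift m S) :
    IsMartingaleCoupling (γ - m + m') := by
  have := h.isFiniteMeasure
  have := isFiniteMeasure_of_le γ hm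
  have hsub : γ - m ≤ γ := Measure.sub_le
  have := isFiniteMeasure_of_le γ hsub
  refine ⟨inferInstance, (h.integrable_id.mono_measure hsub).add_measure hm', fun S hS => ?_⟩
  rw [drift_add (h.integrable_id.mono_measure hsub) hm', hd S hS,
    ← drift_add (h.integrable_id.mono_measure hsub) (h.integrable_id.mono_measure hm),
    Measure.sub_add_cancel_of_le hm, h.drift_eq_zero S hS]

lemma integrable_id_of_hasSubmarginals (h : IsMartingaleCoupling γ)
    (hm : HasSubmarginals m γ.fst γ.snd) : Integrable id m := by
  refine integrable_prod.mpr ⟨hm.integrable_comp_fst (f := id) ?_,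
    hm.integrable_comp_snd (f := id) ?_⟩
  · exact (integrable_map_measure (by fun_prop) (by fun_prop)).mpr h.integrable_id.fst
  · exact (integrable_map_measure (by fun_prop) (by fun_prop)).mpr h.integrable_id.snd

end Operations

section CompProd

variable {μ ρ : Measure ℝ} {κ : Kernel ℝ ℝ}

lemma ae_integral_eq [SFinite μ] [IsMarkovKernel κ] (h : IsMartingaleCoupling (μ ⊗ₘ κ)) :
    ∀ᵐ x ∂μ, Integrable (fun y => y) (κ x) ∧ ∫ y, y ∂κ x = x := by
  have hdisp : (fun x => ∫ y, (y - x) ∂κ x) =ᵐ[μ] 0 := by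
    refine (integrable_integral_compProd (integrable_snd_sub_fst
      h.integrable_id)).ae_eq_zero_of_forall_setIntegral_eq_zero fun S hS _ => ?_
    rw [← h.drift_eq_zero S hS, drift_compProd h.integrable_id hS]
  have hint : ∀ᵐ x ∂μ, Integrable (fun y => y) (κ x) :=
    ((Measure.integrable_compProd_iff (by fun_prop)).mp h.integrable_id.snd).1
  filter_upwards [hdisp, hint] with x hx hκ
  rw [integral_sub hκ (integrable_const x)] at hx
  exact ⟨hκ, by simpa [sub_eq_zero] using hx⟩

lemma compProd_of_le [IsFiniteMeasure μ] [IsMarkovKernel κ] (h : IsMartingaleCoupling (μ ⊗ₘ κ))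
    (hρ : ρ ≤ μ) : IsMartingaleCoupling (ρ ⊗ₘ κ) := by
  have := isFiniteMeasure_of_le μ hρ
  have hint : Integrable id (ρ ⊗ₘ κ) := h.integrable_id.mono_measure (compProd_mono_left hρ)
  refine ⟨inferInstance, hint, fun S hS => ?_⟩
  rw [drift_compProd hint hS]
  refine integral_eq_zero_of_ae (ae_restrict_of_ae ?_)
  filter_upwards [ae_mono hρ h.ae_integral_eq] with x ⟨hκ, hx⟩
  rw [integral_sub hκ (integrable_const x), hx]
  simp

end CompProd

section Transports

variable {π γ : Measure (ℝ × ℝ)} {μ ν : Measure ℝ}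

lemma of_mem_martingaleTransports (h : π ∈ martingaleTransports μ ν) :
    IsMartingaleCoupling π := by
  obtain ⟨⟨hprob, hnorm⟩, -, -, hcond⟩ := h
  have hint : Integrable id π := (integrable_norm_iff (by fun_prop)).mp hnorm
  refine ⟨inferInstance, hint, fun S hS => ?_⟩
  rw [drift_eq_sub hint, sub_eq_zero]
  exact (setIntegral_condExp measurable_fst.comap_le hint.snd ⟨S, hS, rfl⟩).symm.trans
    (integral_congr_ae (ae_restrict_of_ae hcond))

lemma condExp_snd_eq_fst (h : IsMartingaleCoupling γ) :
    γ[(Prod.snd : ℝ × ℝ → ℝ) | MeasurableSpace.comap (Prod.fst : ℝ × ℝ → ℝ) inferInstance]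
      =ᵐ[γ] (Prod.fst : ℝ × ℝ → ℝ) := by
  have := h.isFiniteMeasure
  refine (ae_eq_condExp_of_forall_setIntegral_eq measurable_fst.comap_le h.integrable_id.snd
    (fun s _ _ => h.integrable_id.fst.integrableOn) ?_
    (comap_measurable Prod.fst).stronglyMeasurable.aestronglyMeasurable).symm
  rintro s ⟨S, hS, rfl⟩ -
  have hd := h.drift_eq_zero S hS
  rw [drift_eq_sub h.integrable_id, sub_eq_zero] at hd
  exact hd.symm

lemma mem_martingaleTransports [IsProbabilityMeasure π] (h : IsMartingaleCoupling π) :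
    π ∈ martingaleTransports π.fst π.snd :=
  ⟨⟨inferInstance, h.integrable_id.norm⟩, rfl, rfl, h.condExp_snd_eq_fst⟩

lemma finiteMomentProb_fst [IsProbabilityMeasure π] (h : IsMartingaleCoupling π) :
    FiniteMomentProb π.fst :=
  ⟨inferInstance,
    (integrable_map_measure (by fun_prop) (by fun_prop)).mpr h.integrable_id.fst.norm⟩

lemma finiteMomentProb_snd [IsProbabilityMeasure π] (h : IsMartingaleCoupling π) :
    FiniteMomentProb π.snd :=
  ⟨inferInstance,
    (integrable_map_measure (by fun_prop) (by fun_prop)).mpr h.integrable_id.snd.norm⟩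

lemma convexOrder (h : IsMartingaleCoupling γ) : ConvexOrder γ.fst γ.snd := by
  intro f hf hint
  have := h.isFiniteMeasure
  have hcont : Continuous f := continuousOn_univ.mp (hf.continuousOn isOpen_univ)
  have hint' : Integrable (fun p : ℝ × ℝ => f p.2) γ := hint.comp_measurable measurable_snd
  have hjensen : ∀ᵐ p ∂γ, f p.1 ≤
      (γ[(f ∘ Prod.snd : ℝ × ℝ → ℝ) | MeasurableSpace.comap (Prod.fst : ℝ × ℝ → ℝ) inferInstance])
        p := by
    filter_upwards [h.condExp_snd_eq_fst, hf.map_condExp_le_univ measurable_fst.comap_le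
      hcont.lowerSemicontinuous (f := Prod.snd) h.integrable_id.snd hint'] with p hp hle
    rwa [Function.comp_apply, hp] at hle
  obtain ⟨a, b, hab⟩ : ∃ a b : ℝ, ∀ x, a * x + b ≤ f x := by
    simpa using hf.exists_affine_le_real isClosed_univ
      (hcont.lowerSemicontinuous.lowerSemicontinuousOn _)
  have hfst : Integrable (fun p : ℝ × ℝ => f p.1) γ :=
    integrable_of_le_of_le (by fun_prop) (.of_forall fun p => hab p.1) hjensen
      ((h.integrable_id.fst.const_mul a).add (integrable_const b)) integrable_condExp
  refine ⟨(integrable_map_measure (by fun_prop) (by fun_prop)).mpr hfst, ?_⟩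
  calc ∫ x, f x ∂γ.fst = ∫ p, f p.1 ∂γ := integral_map (by fun_prop) (by fun_prop)
    _ ≤ ∫ p, (γ[(f ∘ Prod.snd : ℝ × ℝ → ℝ) |
        MeasurableSpace.comap (Prod.fst : ℝ × ℝ → ℝ) inferInstance]) p ∂γ :=
      integral_mono_ae hfst integrable_condExp hjensen
    _ = ∫ p, f p.2 ∂γ := integral_condExp measurable_fst.comap_le
    _ = ∫ y, f y ∂γ.snd := (integral_map (by fun_prop) (by fun_prop)).symm

lemma mem_finiteMartingaleTransports (h : IsMartingaleCoupling γ) :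
    γ ∈ finiteMartingaleTransports := by
  have := h.isFiniteMeasure
  rcases eq_or_ne γ 0 with rfl | hγ
  · exact Or.inl rfl
  have : NeZero γ := ⟨hγ⟩
  have hnorm : IsMartingaleCoupling ((γ Set.univ)⁻¹ • γ) :=
    h.smul (ENNReal.inv_ne_top.mpr (Measure.measure_univ_ne_zero.mpr hγ))
  exact Or.inr ⟨Measure.measure_univ_ne_zero.mpr hγ, measure_ne_top γ _, _, _,
    hnorm.finiteMomentProb_fst, hnorm.finiteMomentProb_snd, hnorm.convexOrder,
    hnorm.mem_martingaleTransports⟩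

end Transports

end IsMartingaleCoupling

section Payoff

variable {c₁ : ℝ → ℝ} {c₂ : ℝ → ℝ → ℝ} {μ ν : Measure ℝ}

/-- The standing assumptions on the payoffs: measurability, and domination by a sum `v x + w y` of
functions integrable for the two marginals. -/
structure IsAdmissiblePayoff (c₁ : ℝ → ℝ) (c₂ : ℝ → ℝ → ℝ) (μ ν : Measure ℝ) : Prop where
  measurable_left : Measurable c₁
  measurable_right : Measurable fun p : ℝ × ℝ => c₂ p.1 p.2
  exists_bound : ∃ v w : ℝ → ℝ, Integrable v μ ∧ Integrable w ν ∧
    ∀ x y : ℝ, |c₁ x| + |c₂ x y| ≤ v x + w y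

namespace IsAdmissiblePayoff

variable {τ γ₁ γ₂ γ₁' γ₂' : Measure (ℝ × ℝ)}

lemma integrable_left (hc : IsAdmissiblePayoff c₁ c₂ μ ν) (hτ : HasSubmarginals τ μ ν) :
    Integrable (fun p => c₁ p.1) τ := by
  obtain ⟨v, w, hv, hw, hvw⟩ := hc.exists_bound
  refine ((hτ.integrable_comp_fst hv).add (hτ.integrable_comp_snd hw)).mono'
    (hc.measurable_left.comp measurable_fst).aestronglyMeasurable (.of_forall fun p => ?_)
  exact (le_add_of_nonneg_right (abs_nonneg _)).trans (hvw p.1 p.2)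

lemma integrable_right (hc : IsAdmissiblePayoff c₁ c₂ μ ν) (hτ : HasSubmarginals τ μ ν) :
    Integrable (fun p => c₂ p.1 p.2) τ := by
  obtain ⟨v, w, hv, hw, hvw⟩ := hc.exists_bound
  refine ((hτ.integrable_comp_fst hv).add (hτ.integrable_comp_snd hw)).mono'
    hc.measurable_right.aestronglyMeasurable (.of_forall fun p => ?_)
  exact (le_add_of_nonneg_left (abs_nonneg _)).trans (hvw p.1 p.2)

lemma integrable_right_comp (hc : IsAdmissiblePayoff c₁ c₂ μ ν) {Ω : Type*} [MeasurableSpace Ω]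
    {P : Measure Ω} {X Y : Ω → ℝ} (hX : Measurable X) (hY : Measurable Y) (hXμ : P.map X ≤ μ)
    (hYν : P.map Y ≤ ν) : Integrable (fun ω => c₂ (X ω) (Y ω)) P :=
  (hc.integrable_right ((hasSubmarginals_map_iff hX hY).mpr ⟨hXμ, hYν⟩)).comp_measurable
    (hX.prodMk hY)

lemma pairPayoff_add (hc : IsAdmissiblePayoff c₁ c₂ μ ν) (h₁ : HasSubmarginals γ₁ μ ν)
    (h₂ : HasSubmarginals γ₂ μ ν) (h₁' : HasSubmarginals γ₁' μ ν)
    (h₂' : HasSubmarginals γ₂' μ ν) :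
    pairPayoff c₁ c₂ (γ₁ + γ₁') (γ₂ + γ₂') =
      pairPayoff c₁ c₂ γ₁ γ₂ + pairPayoff c₁ c₂ γ₁' γ₂' := by
  simp only [pairPayoff]
  rw [integral_add_measure (hc.integrable_left h₁) (hc.integrable_left h₁'),
    integral_add_measure (hc.integrable_right h₂) (hc.integrable_right h₂')]
  exact add_add_add_comm _ _ _ _

end IsAdmissiblePayoff

lemma pairPayoff_smul (c₁ : ℝ → ℝ) (c₂ : ℝ → ℝ → ℝ) (a : ℝ≥0∞) (γ₁ γ₂ : Measure (ℝ × ℝ)) :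
    pairPayoff c₁ c₂ (a • γ₁) (a • γ₂) = a.toReal * pairPayoff c₁ c₂ γ₁ γ₂ := by
  simp only [pairPayoff, integral_smul_measure, smul_eq_mul, mul_add]

end Payoff

lemma sub_add_add_sub_add_of_le {α : Type*} [MeasurableSpace α] {γ₁ γ₂ m₁ m₂ : Measure α}
    [IsFiniteMeasure m₁] [IsFiniteMeasure m₂] (h₁ : m₁ ≤ γ₁) (h₂ : m₂ ≤ γ₂) (m₁' m₂' : Measure α) :
    γ₁ - m₁ + m₁' + (γ₂ - m₂ + m₂') + (m₁ + m₂) = γ₁ + γ₂ + (m₁' + m₂') := by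
  calc γ₁ - m₁ + m₁' + (γ₂ - m₂ + m₂') + (m₁ + m₂)
      = γ₁ - m₁ + m₁ + (γ₂ - m₂ + m₂) + (m₁' + m₂') := by ac_rfl
    _ = γ₁ + γ₂ + (m₁' + m₂') := by
      rw [Measure.sub_add_cancel_of_le h₁, Measure.sub_add_cancel_of_le h₂]

/-- `γ₁` and `γ₂` solve the relaxed problem with marginals `μ` and `ν`: exercise at the first date
along `γ₁` and at the second date along `γ₂`. -/
structure IsRelaxedOptimal (c₁ : ℝ → ℝ) (c₂ : ℝ → ℝ → ℝ) (μ ν : Measure ℝ)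
    (γ₁ γ₂ : Measure (ℝ × ℝ)) : Prop where
  left : IsMartingaleCoupling γ₁
  right : IsMartingaleCoupling γ₂
  fst_add : (γ₁ + γ₂).fst = μ
  snd_add : (γ₁ + γ₂).snd = ν
  pairPayoff_le : ∀ γ₁' γ₂', IsMartingaleCoupling γ₁' → IsMartingaleCoupling γ₂' →
    (γ₁' + γ₂').fst = μ → (γ₁' + γ₂').snd = ν → pairPayoff c₁ c₂ γ₁' γ₂' ≤ pairPayoff c₁ c₂ γ₁ γ₂

namespace IsRelaxedOptimal

variable {c₁ : ℝ → ℝ} {c₂ : ℝ → ℝ → ℝ} {μ ν : Measure ℝ} {γ₁ γ₂ σ m₁ m₂ m₁' m₂' : Measure (ℝ × ℝ)}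

lemma hasSubmarginals (h : IsRelaxedOptimal c₁ c₂ μ ν γ₁ γ₂) (hσ : σ ≤ γ₁ + γ₂) :
    HasSubmarginals σ μ ν :=
  HasSubmarginals.mono ⟨h.fst_add.le, h.snd_add.le⟩ hσ

lemma hasSubmarginals_left (h : IsRelaxedOptimal c₁ c₂ μ ν γ₁ γ₂) (hσ : σ ≤ γ₁) :
    HasSubmarginals σ μ ν :=
  h.hasSubmarginals (hσ.trans (Measure.le_add_right le_rfl))

lemma hasSubmarginals_right (h : IsRelaxedOptimal c₁ c₂ μ ν γ₁ γ₂) (hσ : σ ≤ γ₂) :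
    HasSubmarginals σ μ ν :=
  h.hasSubmarginals (hσ.trans (Measure.le_add_left le_rfl))

lemma isFiniteMeasure_fst (h : IsRelaxedOptimal c₁ c₂ μ ν γ₁ γ₂) : IsFiniteMeasure μ := by
  have := (h.left.add h.right).isFiniteMeasure
  rw [← h.fst_add]
  infer_instance

lemma integrable_id (h : IsRelaxedOptimal c₁ c₂ μ ν γ₁ γ₂) (hσ : HasSubmarginals σ μ ν) :
    Integrable id σ :=
  (h.left.add h.right).integrable_id_of_hasSubmarginals (by rwa [h.fst_add, h.snd_add])

theorem pairPayoff_exchange_le (h : IsRelaxedOptimal c₁ c₂ μ ν γ₁ γ₂)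
    (hc : IsAdmissiblePayoff c₁ c₂ μ ν) (hm₁ : m₁ ≤ γ₁) (hm₂ : m₂ ≤ γ₂)
    (hfst : (m₁' + m₂').fst = (m₁ + m₂).fst) (hsnd : (m₁' + m₂').snd = (m₁ + m₂).snd)
    (hd₁ : ∀ S, MeasurableSet S → drift m₁' S = drift m₁ S)
    (hd₂ : ∀ S, MeasurableSet S → drift m₂' S = drift m₂ S) :
    pairPayoff c₁ c₂ m₁' m₂' ≤ pairPayoff c₁ c₂ m₁ m₂ := by
  have := h.isFiniteMeasure_fst
  have hs' : HasSubmarginals (m₁' + m₂') μ ν := by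
    have hs := h.hasSubmarginals (add_le_add hm₁ hm₂)
    exact ⟨hfst.trans_le hs.fst_le, hsnd.trans_le hs.snd_le⟩
  have hs₁' := hs'.mono (Measure.le_add_right le_rfl : m₁' ≤ _)
  have hs₂' := hs'.mono (Measure.le_add_left le_rfl : m₂' ≤ _)
  have := hs₁'.isFiniteMeasure
  have := hs₂'.isFiniteMeasure
  have := (h.hasSubmarginals_left hm₁).isFiniteMeasure
  have := (h.hasSubmarginals_right hm₂).isFiniteMeasure
  have hbal := sub_add_add_sub_add_of_le hm₁ hm₂ m₁' m₂'
  have hopt := h.pairPayoff_le (γ₁ - m₁ + m₁') (γ₂ - m₂ + m₂')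
    (h.left.exchange hm₁ (h.integrable_id hs₁') hd₁)
    (h.right.exchange hm₂ (h.integrable_id hs₂') hd₂)
    (by
      have := congrArg Measure.fst hbal
      rwa [Measure.fst_add, Measure.fst_add (μ := γ₁ + γ₂), h.fst_add, hfst,
        Measure.add_left_inj] at this)
    (by
      have := congrArg Measure.snd hbal
      rwa [Measure.snd_add, Measure.snd_add (μ := γ₁ + γ₂), h.snd_add, hsnd,
        Measure.add_left_inj] at this)
  have hsub₁ := h.hasSubmarginals_left (Measure.sub_le (μ := γ₁) (ν := m₁))
  have hsub₂ := h.hasSubmarginals_right (Measure.sub_le (μ := γ₂) (ν := m₂))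
  have hsplit := hc.pairPayoff_add hsub₁ hsub₂ (h.hasSubmarginals_left hm₁)
    (h.hasSubmarginals_right hm₂)
  rw [Measure.sub_add_cancel_of_le hm₁, Measure.sub_add_cancel_of_le hm₂] at hsplit
  rw [hc.pairPayoff_add hsub₁ hsub₂ hs₁' hs₂', hsplit] at hopt
  exact le_of_add_le_add_left hopt

end IsRelaxedOptimal

lemma drift_map_eq_of_setIntegral_sub_eq_zero {Ω : Type*} [MeasurableSpace Ω] {τ : Measure Ω}
    {X Y Z : Ω → ℝ} (hX : Measurable X) (hY : Measurable Y) (hZ : Measurable Z)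
    (hXY : Integrable id (τ.map fun ω => (X ω, Y ω)))
    (hXZ : Integrable id (τ.map fun ω => (X ω, Z ω))) {S : Set ℝ} (hS : MeasurableSet S)
    (h : ∫ ω in X ⁻¹' S, (Y ω - Z ω) ∂τ = 0) :
    drift (τ.map fun ω => (X ω, Y ω)) S = drift (τ.map fun ω => (X ω, Z ω)) S := by
  have hY' := (integrable_snd_sub_fst hXY).comp_measurable (hX.prodMk hY)
  have hZ' := (integrable_snd_sub_fst hXZ).comp_measurable (hX.prodMk hZ)
  rw [drift_map hX hY hS, drift_map hX hZ hS, ← sub_eq_zero]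
  refine (integral_sub hY'.integrableOn hZ'.integrableOn).symm.trans ?_
  simpa only [Function.comp_apply, sub_sub_sub_cancel_right] using h

theorem IsRelaxedOptimal.integral_sub_nonpos_of_swap {c₁ : ℝ → ℝ} {c₂ : ℝ → ℝ → ℝ}
    {μ ν : Measure ℝ} {γ₁ γ₂ : Measure (ℝ × ℝ)} (h : IsRelaxedOptimal c₁ c₂ μ ν γ₁ γ₂)
    (hc : IsAdmissiblePayoff c₁ c₂ μ ν) {Ω : Type*} [MeasurableSpace Ω] {τ : Measure Ω}
    {X X' Y Z : Ω → ℝ} (hX : Measurable X) (hX' : Measurable X') (hY : Measurable Y)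
    (hZ : Measurable Z) (hXY : τ.map (fun ω => (X ω, Y ω)) ≤ γ₁)
    (hXZ : τ.map (fun ω => (X' ω, Z ω)) ≤ γ₂)
    (hbal : ∀ S, MeasurableSet S → ∫ ω in X ⁻¹' S, (Y ω - Z ω) ∂τ = 0)
    (hbal' : ∀ S, MeasurableSet S → ∫ ω in X' ⁻¹' S, (Y ω - Z ω) ∂τ = 0) :
    ∫ ω, (c₂ (X' ω) (Y ω) - c₂ (X' ω) (Z ω)) ∂τ ≤ 0 := by
  have hm₁ := h.hasSubmarginals_left hXY
  have hm₂ := h.hasSubmarginals_right hXZ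
  obtain ⟨hXμ, hYν⟩ := (hasSubmarginals_map_iff hX hY).mp hm₁
  obtain ⟨hX'μ, hZν⟩ := (hasSubmarginals_map_iff hX' hZ).mp hm₂
  have hm₁' := (hasSubmarginals_map_iff hX hZ).mpr ⟨hXμ, hZν⟩
  have hm₂' := (hasSubmarginals_map_iff hX' hY).mpr ⟨hX'μ, hYν⟩
  have hle := h.pairPayoff_exchange_le hc hXY hXZ
    (m₁' := τ.map fun ω => (X ω, Z ω)) (m₂' := τ.map fun ω => (X' ω, Y ω))
    (by simp only [Measure.fst_add, Measure.fst_map_prodMk hY, Measure.fst_map_prodMk hZ])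
    (by simp only [Measure.snd_add, Measure.snd_map_prodMk hX, Measure.snd_map_prodMk hX',
      add_comm])
    (fun S hS => (drift_map_eq_of_setIntegral_sub_eq_zero hX hY hZ (h.integrable_id hm₁)
      (h.integrable_id hm₁') hS (hbal S hS)).symm)
    (fun S hS => drift_map_eq_of_setIntegral_sub_eq_zero hX' hY hZ (h.integrable_id hm₂')
      (h.integrable_id hm₂) hS (hbal' S hS))
  have hc₁ {U : Ω → ℝ} (hU : Measurable U) :
      ∫ p, c₁ p.1 ∂τ.map (fun ω => (X ω, U ω)) = ∫ ω, c₁ (X ω) ∂τ :=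
    integral_map (hX.prodMk hU).aemeasurable
      (hc.measurable_left.comp measurable_fst).aestronglyMeasurable
  have hc₂ {U : Ω → ℝ} (hU : Measurable U) :
      ∫ p, c₂ p.1 p.2 ∂τ.map (fun ω => (X' ω, U ω)) = ∫ ω, c₂ (X' ω) (U ω) ∂τ :=
    integral_map (hX'.prodMk hU).aemeasurable hc.measurable_right.aestronglyMeasurable
  rw [pairPayoff, pairPayoff, hc₁ hZ, hc₁ hY, hc₂ hY, hc₂ hZ] at hle
  rw [integral_sub (hc.integrable_right_comp hX' hY hX'μ hYν)
    (hc.integrable_right_comp hX' hZ hX'μ hZν)]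
  exact sub_nonpos.mpr (le_of_add_le_add_left hle)

/-- The weight of `y₁` in the representation of `z` as a barycentre of `y₁` and `y₂`, if `z` lies
strictly between these points. It is set to `0` otherwise, so that it can serve as a density with
respect to the law of random `z`, `y₁`, `y₂`. -/
noncomputable def baryWeight (z y₁ y₂ : ℝ) : NNReal :=
  open Classical in if z ∈ Set.uIoo y₁ y₂ then ((z - y₂) / (y₁ - y₂)).toNNReal else 0

section BaryWeight

variable {y₁ y₂ z : ℝ}

lemma baryWeight_of_notMem (hz : z ∉ Set.uIoo y₁ y₂) : baryWeight z y₁ y₂ = 0 :=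
  if_neg hz

lemma ne_of_mem_uIoo {α : Type*} [LinearOrder α] {a b x : α} (hx : x ∈ Set.uIoo a b) : a ≠ b := by
  rintro rfl
  simp at hx

lemma div_sub_mem_Ioo_of_mem_uIoo (hz : z ∈ Set.uIoo y₁ y₂) :
    (z - y₂) / (y₁ - y₂) ∈ Set.Ioo 0 1 := by
  rcases (ne_of_mem_uIoo hz).lt_or_gt with h | h
  · rw [Set.uIoo_of_lt h] at hz
    rw [← neg_div_neg_eq, neg_sub, neg_sub]
    exact ⟨div_pos (sub_pos.mpr hz.2) (sub_pos.mpr h),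
      (div_lt_one (sub_pos.mpr h)).mpr (sub_lt_sub_left hz.1 y₂)⟩
  · rw [Set.uIoo_of_gt h] at hz
    exact ⟨div_pos (sub_pos.mpr hz.1) (sub_pos.mpr h),
      (div_lt_one (sub_pos.mpr h)).mpr (sub_lt_sub_right hz.2 y₂)⟩

lemma coe_baryWeight (hz : z ∈ Set.uIoo y₁ y₂) :
    (baryWeight z y₁ y₂ : ℝ) = (z - y₂) / (y₁ - y₂) := by
  rw [baryWeight, if_pos hz, Real.coe_toNNReal _ (div_sub_mem_Ioo_of_mem_uIoo hz).1.le]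

lemma baryWeight_pos (hz : z ∈ Set.uIoo y₁ y₂) : 0 < (baryWeight z y₁ y₂ : ℝ) :=
  (div_sub_mem_Ioo_of_mem_uIoo hz).1.trans_eq (coe_baryWeight hz).symm

lemma baryWeight_le_one (z y₁ y₂ : ℝ) : baryWeight z y₁ y₂ ≤ 1 := by
  by_cases hz : z ∈ Set.uIoo y₁ y₂
  · rw [← NNReal.coe_le_coe, coe_baryWeight hz]
    exact (div_sub_mem_Ioo_of_mem_uIoo hz).2.le
  · rw [baryWeight_of_notMem hz]
    exact zero_le_one

lemma baryWeight_add_swap (hz : z ∈ Set.uIoo y₁ y₂) :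
    (baryWeight z y₁ y₂ : ℝ) + baryWeight z y₂ y₁ = 1 := by
  rw [coe_baryWeight hz, coe_baryWeight (Set.uIoo_comm y₁ y₂ ▸ hz)]
  have h₁ := sub_ne_zero.mpr (ne_of_mem_uIoo hz)
  have h₂ := sub_ne_zero.mpr (ne_of_mem_uIoo hz).symm
  field_simp
  ring

lemma baryWeight_smul_add_swap (hz : z ∈ Set.uIoo y₁ y₂) :
    (baryWeight z y₁ y₂ : ℝ) • y₁ + (baryWeight z y₂ y₁ : ℝ) • y₂ = z := by
  have h₁ := sub_ne_zero.mpr (ne_of_mem_uIoo hz)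
  rw [eq_sub_of_add_eq' (baryWeight_add_swap hz), coe_baryWeight hz, smul_eq_mul, smul_eq_mul]
  field_simp
  ring

lemma baryWeight_smul_sub_swap (z y₁ y₂ : ℝ) :
    baryWeight z y₂ y₁ • (y₂ - z) = -(baryWeight z y₁ y₂ • (y₁ - z)) := by
  by_cases hz : z ∈ Set.uIoo y₁ y₂
  · have h := baryWeight_smul_add_swap hz
    simp only [NNReal.smul_def, smul_eq_mul] at h ⊢
    linear_combination h - z * baryWeight_add_swap hz
  · rw [baryWeight_of_notMem hz, baryWeight_of_notMem (Set.uIoo_comm y₁ y₂ ▸ hz), zero_smul,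
      zero_smul, neg_zero]

lemma baryWeight_smul_sub_add_swap_pos {f : ℝ → ℝ} (hf : StrictConvexOn ℝ Set.univ f)
    (hz : z ∈ Set.uIoo y₁ y₂) :
    0 < baryWeight z y₁ y₂ • (f y₁ - f z) + baryWeight z y₂ y₁ • (f y₂ - f z) := by
  have hlt := hf.2 (Set.mem_univ y₁) (Set.mem_univ y₂) (ne_of_mem_uIoo hz) (baryWeight_pos hz)
    (baryWeight_pos (Set.uIoo_comm y₁ y₂ ▸ hz)) (baryWeight_add_swap hz)
  rw [baryWeight_smul_add_swap hz] at hlt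
  simp only [NNReal.smul_def, smul_eq_mul] at hlt ⊢
  linear_combination hlt + f z * baryWeight_add_swap hz

lemma measurable_baryWeight {Ω : Type*} [MeasurableSpace Ω] {Y₁ Y₂ Z : Ω → ℝ}
    (hZ : Measurable Z) (hY₁ : Measurable Y₁) (hY₂ : Measurable Y₂) :
    Measurable fun ω => baryWeight (Z ω) (Y₁ ω) (Y₂ ω) :=
  Measurable.ite ((measurableSet_lt (hY₁.min hY₂) hZ).inter (measurableSet_lt hZ (hY₁.max hY₂)))
    (by fun_prop) measurable_const

end BaryWeight

section Symmetrization

variable {Ω : Type*} [MeasurableSpace Ω] {Q : Measure Ω} {s : Ω ≃ᵐ Ω}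

lemma setIntegral_eq_zero_of_comp_eq_neg (hs : MeasurePreserving s Q Q) {A : Set Ω}
    (hA : s ⁻¹' A = A) {E : Type*} [NormedAddCommGroup E] [NormedSpace ℝ E] {g : Ω → E}
    (hg : ∀ ω, g (s ω) = -g ω) : ∫ ω in A, g ω ∂Q = 0 := by
  have h := hs.setIntegral_preimage_emb s.measurableEmbedding g A
  simp only [hA, hg, integral_neg] at h
  have : IsAddTorsionFree E := .of_isTorsionFree ℝ E
  exact neg_eq_self.mp h

lemma ae_add_comp_eq_zero (hs : MeasurePreserving s Q Q) {G : Ω → ℝ} (hG : Integrable G Q)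
    (hle : ∫ ω, G ω ∂Q ≤ 0) (hnonneg : ∀ᵐ ω ∂Q, 0 ≤ G ω + G (s ω)) :
    ∀ᵐ ω ∂Q, G ω + G (s ω) = 0 := by
  have hGs : Integrable (fun ω => G (s ω)) Q := hs.integrable_comp_of_integrable hG
  refine (integral_eq_zero_iff_of_nonneg_ae hnonneg (hG.add hGs)).mp
    (le_antisymm ?_ (integral_nonneg_of_ae hnonneg))
  rw [integral_add hG hGs, hs.integral_comp' G]
  exact add_nonpos hle hle

end Symmetrization

section Exchange

variable {c₁ : ℝ → ℝ} {c₂ : ℝ → ℝ → ℝ} {μ ν : Measure ℝ} {γ₁ γ₂ : Measure (ℝ × ℝ)}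
  {Ω : Type*} [MeasurableSpace Ω] {Q : Measure Ω} {X X' Y Z : Ω → ℝ}

lemma IsRelaxedOptimal.integral_smul_sub_nonpos_of_swap (h : IsRelaxedOptimal c₁ c₂ μ ν γ₁ γ₂)
    (hc : IsAdmissiblePayoff c₁ c₂ μ ν) (hX : Measurable X) (hX' : Measurable X')
    (hY : Measurable Y) (hZ : Measurable Z) (hXY : Q.map (fun ω => (X ω, Y ω)) ≤ γ₁)
    (hXZ : Q.map (fun ω => (X' ω, Z ω)) ≤ γ₂) {w : Ω → NNReal} (hw : Measurable w)
    (hw_le : ∀ ω, w ω ≤ 1)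
    (hbal : ∀ S, MeasurableSet S → ∫ ω in X ⁻¹' S, w ω • (Y ω - Z ω) ∂Q = 0)
    (hbal' : ∀ S, MeasurableSet S → ∫ ω in X' ⁻¹' S, w ω • (Y ω - Z ω) ∂Q = 0) :
    ∫ ω, w ω • (c₂ (X' ω) (Y ω) - c₂ (X' ω) (Z ω)) ∂Q ≤ 0 := by
  have hle : Q.withDensity (fun ω => w ω) ≤ Q := by
    conv_rhs => rw [← withDensity_one (μ := Q)]
    exact withDensity_mono (.of_forall fun ω => ENNReal.coe_le_one_iff.mpr (hw_le ω))
  rw [← integral_withDensity_eq_integral_smul hw]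
  exact h.integral_sub_nonpos_of_swap hc hX hX' hY hZ
    ((Measure.map_mono hle (hX.prodMk hY)).trans hXY)
    ((Measure.map_mono hle (hX'.prodMk hZ)).trans hXZ)
    (fun S hS => (setIntegral_withDensity_eq_setIntegral_smul hw _ (hX hS)).trans (hbal S hS))
    (fun S hS => (setIntegral_withDensity_eq_setIntegral_smul hw _ (hX' hS)).trans (hbal' S hS))

lemma IsRelaxedOptimal.integrable_right_sub (h : IsRelaxedOptimal c₁ c₂ μ ν γ₁ γ₂)
    (hc : IsAdmissiblePayoff c₁ c₂ μ ν) (hX : Measurable X) (hX' : Measurable X')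
    (hY : Measurable Y) (hZ : Measurable Z) (hXY : Q.map (fun ω => (X ω, Y ω)) ≤ γ₁)
    (hXZ : Q.map (fun ω => (X' ω, Z ω)) ≤ γ₂) :
    Integrable (fun ω => c₂ (X' ω) (Y ω) - c₂ (X' ω) (Z ω)) Q := by
  have hY' := (hasSubmarginals_map_iff hX hY).mp (h.hasSubmarginals_left hXY)
  have hZ' := (hasSubmarginals_map_iff hX' hZ).mp (h.hasSubmarginals_right hXZ)
  exact (hc.integrable_right_comp hX' hY hZ'.1 hY'.2).sub
    (hc.integrable_right_comp hX' hZ hZ'.1 hZ'.2)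

/-- Otherwise one could move the points `Y ω` and `Y (s ω)` from `γ₁` to `γ₂` in exchange for `Z ω`,
with weights that make `Z ω` their barycentre, which by strict convexity increases the payoff. -/
theorem IsRelaxedOptimal.ae_notMem_uIoo (h : IsRelaxedOptimal c₁ c₂ μ ν γ₁ γ₂)
    (hc : IsAdmissiblePayoff c₁ c₂ μ ν) (hX : Measurable X) (hX' : Measurable X')
    (hY : Measurable Y) (hZ : Measurable Z) (hXY : Q.map (fun ω => (X ω, Y ω)) ≤ γ₁)
    (hXZ : Q.map (fun ω => (X' ω, Z ω)) ≤ γ₂) {s : Ω ≃ᵐ Ω} (hs : MeasurePreserving s Q Q)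
    (hss : ∀ ω, s (s ω) = ω) (hXs : ∀ ω, X (s ω) = X ω) (hX's : ∀ ω, X' (s ω) = X' ω)
    (hZs : ∀ ω, Z (s ω) = Z ω) (hconv : ∀ᵐ ω ∂Q, StrictConvexOn ℝ Set.univ (c₂ (X' ω))) :
    ∀ᵐ ω ∂Q, Z ω ∉ Set.uIoo (Y ω) (Y (s ω)) := by
  let w : Ω → NNReal := fun ω => baryWeight (Z ω) (Y ω) (Y (s ω))
  have hw : Measurable w := measurable_baryWeight hZ hY (hY.comp s.measurable)
  have hw_le : ∀ ω, w ω ≤ 1 := fun ω => baryWeight_le_one _ _ _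
  have hws (ω : Ω) : w (s ω) = baryWeight (Z ω) (Y (s ω)) (Y ω) := by simp only [w, hZs, hss]
  have hbal {U : Ω → ℝ} (hUs : ∀ ω, U (s ω) = U ω) (S : Set ℝ) :
      ∫ ω in U ⁻¹' S, w ω • (Y ω - Z ω) ∂Q = 0 :=
    setIntegral_eq_zero_of_comp_eq_neg hs (by ext ω; simp only [Set.mem_preimage, hUs]) fun ω => by
      rw [hws, hZs]
      exact baryWeight_smul_sub_swap _ _ _
  let G : Ω → ℝ := fun ω => w ω • (c₂ (X' ω) (Y ω) - c₂ (X' ω) (Z ω))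
  have hG : Integrable G Q := (h.integrable_right_sub hc hX hX' hY hZ hXY hXZ).bdd_smul 1
    hw.coe_nnreal_real.aestronglyMeasurable (.of_forall fun ω => by simpa using hw_le ω)
  have hG_le : ∫ ω, G ω ∂Q ≤ 0 :=
    h.integral_smul_sub_nonpos_of_swap hc hX hX' hY hZ hXY hXZ hw hw_le (fun S _ => hbal hXs S)
      (fun S _ => hbal hX's S)
  have hG_add (ω : Ω) (hω : StrictConvexOn ℝ Set.univ (c₂ (X' ω)))
      (hz : Z ω ∈ Set.uIoo (Y ω) (Y (s ω))) : 0 < G ω + G (s ω) := by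
    simp only [G, hws, hX's, hZs]
    exact baryWeight_smul_sub_add_swap_pos hω hz
  have hG_zero : ∀ᵐ ω ∂Q, G ω + G (s ω) = 0 := by
    refine ae_add_comp_eq_zero hs hG hG_le (hconv.mono fun ω hω => ?_)
    by_cases hz : Z ω ∈ Set.uIoo (Y ω) (Y (s ω))
    · exact (hG_add ω hω hz).le
    · simp only [G, hws, w, baryWeight_of_notMem hz,
        baryWeight_of_notMem (Set.uIoo_comm (Y ω) _ ▸ hz), zero_smul, add_zero, le_refl]
  filter_upwards [hconv, hG_zero] with ω hω h0 hz
  exact (hG_add ω hω hz).ne' h0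

end Exchange

section Sampling

variable {c₁ : ℝ → ℝ} {c₂ : ℝ → ℝ → ℝ} {μ ν ρ : Measure ℝ} {γ₁ γ₂ : Measure (ℝ × ℝ)}
  {κ : Kernel ℝ ℝ}

theorem IsRelaxedOptimal.ae_snd_uIoo_eq_zero (h : IsRelaxedOptimal c₁ c₂ μ ν γ₁ γ₂)
    (hc : IsAdmissiblePayoff c₁ c₂ μ ν) [IsMarkovKernel κ] (hρ : ρ Set.univ ≤ 1)
    (hle₁ : ρ ⊗ₘ κ ≤ γ₁) (hle₂ : ρ ⊗ₘ κ ≤ γ₂)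
    (hconv : ∀ᵐ x ∂ρ, StrictConvexOn ℝ Set.univ (c₂ x)) :
    ∀ᵐ q ∂(ρ ⊗ₘ (κ ×ₖ κ)), (ρ ⊗ₘ κ).snd (Set.uIoo q.2.1 q.2.2) = 0 := by
  have : IsFiniteMeasure ρ := ⟨hρ.trans_lt ENNReal.one_lt_top⟩
  -- Two conditionally independent draws `Y`, `Y'` from `κ X`, and an independent pair `(X', Z)`.
  let Q : Measure ((ℝ × ℝ × ℝ) × ℝ × ℝ) := (ρ ⊗ₘ (κ ×ₖ κ)).prod (ρ ⊗ₘ κ)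
  have smul_le (τ : Measure (ℝ × ℝ)) : ρ Set.univ • τ ≤ τ := by
    conv_rhs => rw [← one_smul ℝ≥0∞ τ]
    gcongr
  have hXY : Q.map (fun ω => (ω.1.1, ω.1.2.1)) ≤ γ₁ := by
    change Q.map ((fun q : ℝ × ℝ × ℝ => (q.1, q.2.1)) ∘ Prod.fst) ≤ γ₁
    rw [← Measure.map_map (by fun_prop) (by fun_prop), Measure.map_fst_prod, Measure.map_smul,
      map_compProd_prod_left, Measure.compProd_apply_univ]
    exact (smul_le _).trans hle₁
  have hXZ : Q.map (fun ω => (ω.2.1, ω.2.2)) ≤ γ₂ := by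
    change Q.map Prod.snd ≤ γ₂
    rw [Measure.map_snd_prod, Measure.compProd_apply_univ]
    exact (smul_le _).trans hle₂
  let s : ((ℝ × ℝ × ℝ) × ℝ × ℝ) ≃ᵐ ((ℝ × ℝ × ℝ) × ℝ × ℝ) :=
    ((MeasurableEquiv.refl ℝ).prodCongr MeasurableEquiv.prodComm).prodCongr (.refl (ℝ × ℝ))
  have hs : MeasurePreserving s Q Q := measurePreserving_prodMap_swap.prod (.id _)
  have hconvQ : ∀ᵐ ω ∂Q, StrictConvexOn ℝ Set.univ (c₂ ω.2.1) :=
    Measure.quasiMeasurePreserving_snd.ae (ae_compProd_fst_of_ae hconv)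
  have hae := h.ae_notMem_uIoo hc (X := fun ω => ω.1.1) (X' := fun ω => ω.2.1)
    (Y := fun ω => ω.1.2.1) (Z := fun ω => ω.2.2) (by fun_prop) (by fun_prop) (by fun_prop)
    (by fun_prop) hXY hXZ hs (fun _ => rfl) (fun _ => rfl) (fun _ => rfl) (fun _ => rfl) hconvQ
  filter_upwards [Measure.ae_ae_of_ae_prod hae] with q hq
  rw [Set.uIoo, Measure.snd_apply measurableSet_Ioo]
  exact measure_eq_zero_iff_ae_notMem.mpr hq

end Sampling

section Gaps

variable {α : Type*} [LinearOrder α] [TopologicalSpace α] [OrderTopology α]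
  [SecondCountableTopology α] [MeasurableSpace α] (m : Measure α) [NullSingletonClass m]

lemma ae_measure_Ioo_ne_zero : ∀ᵐ y ∂m, ∀ z, y < z → m (Set.Ioo y z) ≠ 0 := by
  filter_upwards [(countable_setOfPred_isolated_right_within (s := m.support)).ae_notMem m,
    m.support_mem_ae] with y hy hmem z hyz hz
  refine hy ⟨hmem, ?_⟩
  rw [← Filter.empty_mem_iff_bot, mem_nhdsWithin]
  exact ⟨Set.Iio z, isOpen_Iio, hyz, fun t ht =>
    Measure.subset_compl_support_of_isOpen isOpen_Ioo hz ⟨ht.2.2, ht.1⟩ ht.2.1⟩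

variable {m}

theorem ae_eq_of_ae_measure_uIoo_eq_zero {Ω : Type*} [MeasurableSpace Ω] {P : Measure Ω}
    {Y₁ Y₂ : Ω → α} (h₁ : Measure.QuasiMeasurePreserving Y₁ P m)
    (h₂ : Measure.QuasiMeasurePreserving Y₂ P m)
    (h : ∀ᵐ ω ∂P, m (Set.uIoo (Y₁ ω) (Y₂ ω)) = 0) : Y₁ =ᵐ[P] Y₂ := by
  filter_upwards [h, h₁.ae (ae_measure_Ioo_ne_zero m), h₂.ae (ae_measure_Ioo_ne_zero m)]
    with ω hω hgap₁ hgap₂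
  rcases lt_trichotomy (Y₁ ω) (Y₂ ω) with hlt | heq | hlt
  · exact absurd (Set.uIoo_of_lt hlt ▸ hω) (hgap₁ _ hlt)
  · exact heq
  · exact absurd (Set.uIoo_of_gt hlt ▸ hω) (hgap₂ _ hlt)

end Gaps

section Diagonal

variable {c₁ : ℝ → ℝ} {c₂ : ℝ → ℝ → ℝ} {μ ν ρ : Measure ℝ} {γ₁ γ₂ σ : Measure (ℝ × ℝ)}
  {κ : Kernel ℝ ℝ}

lemma IsMartingaleCoupling.ae_snd_eq_fst [SFinite ρ] [IsMarkovKernel κ]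
    (h : IsMartingaleCoupling (ρ ⊗ₘ κ)) (hκ : ∀ᵐ q ∂(ρ ⊗ₘ (κ ×ₖ κ)), q.2.1 = q.2.2) :
    ∀ᵐ p ∂(ρ ⊗ₘ κ), p.2 = p.1 := by
  refine Measure.ae_compProd_of_ae_ae (measurableSet_eq_fun measurable_snd measurable_fst) ?_
  filter_upwards [Measure.ae_ae_of_ae_compProd hκ, h.ae_integral_eq] with x hx ⟨_, hmean⟩
  rw [Kernel.prod_apply] at hx
  filter_upwards [Measure.ae_ae_of_ae_prod hx] with y hy
  calc y = ∫ _, y ∂κ x := by simp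
    _ = ∫ z, z ∂κ x := integral_congr_ae hy
    _ = x := hmean

theorem IsRelaxedOptimal.ae_snd_eq_fst [NullSingletonClass ν]
    (h : IsRelaxedOptimal c₁ c₂ μ ν γ₁ γ₂) (hc : IsAdmissiblePayoff c₁ c₂ μ ν) [IsMarkovKernel κ]
    (hρ : ρ Set.univ ≤ 1) (hle₁ : ρ ⊗ₘ κ ≤ γ₁) (hle₂ : ρ ⊗ₘ κ ≤ γ₂)
    (hm : IsMartingaleCoupling (ρ ⊗ₘ κ))
    (hconv : ∀ᵐ x ∂ρ, StrictConvexOn ℝ Set.univ (c₂ x)) : ∀ᵐ p ∂(ρ ⊗ₘ κ), p.2 = p.1 := by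
  have : IsFiniteMeasure ρ := ⟨hρ.trans_lt ENNReal.one_lt_top⟩
  have : NullSingletonClass (ρ ⊗ₘ κ).snd := ⟨fun y =>
    Measure.absolutelyContinuous_of_le (h.hasSubmarginals_left hle₁).snd_le (measure_singleton y)⟩
  have hlaw : MeasurePreserving (fun q : ℝ × ℝ × ℝ => (q.1, q.2.1)) (ρ ⊗ₘ (κ ×ₖ κ)) (ρ ⊗ₘ κ) :=
    ⟨by fun_prop, map_compProd_prod_left κ⟩
  have hsnd : MeasurePreserving Prod.snd (ρ ⊗ₘ κ) (ρ ⊗ₘ κ).snd := ⟨measurable_snd, rfl⟩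
  have hY₁ := hsnd.comp hlaw
  exact hm.ae_snd_eq_fst (ae_eq_of_ae_measure_uIoo_eq_zero hY₁.quasiMeasurePreserving
    (hY₁.comp measurePreserving_prodMap_swap).quasiMeasurePreserving
    (h.ae_snd_uIoo_eq_zero hc hρ hle₁ hle₂ hconv))

lemma drift_eq_zero_of_ae_eq (h : ∀ᵐ p ∂σ, p.2 = p.1) (S : Set ℝ) : drift σ S = 0 :=
  integral_eq_zero_of_ae (ae_restrict_of_ae (h.mono fun _ hp => sub_eq_zero.mpr hp))

lemma IsRelaxedOptimal.integral_left_eq_right (h : IsRelaxedOptimal c₁ c₂ μ ν γ₁ γ₂)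
    (hc : IsAdmissiblePayoff c₁ c₂ μ ν) (hle₁ : σ ≤ γ₁) (hle₂ : σ ≤ γ₂)
    (hd : ∀ S, MeasurableSet S → drift σ S = 0) :
    ∫ p, c₁ p.1 ∂σ = ∫ p, c₂ p.1 p.2 ∂σ := by
  have hd_zero (S : Set ℝ) : drift 0 S = 0 := by simp [drift]
  have h₁ := h.pairPayoff_exchange_le hc hle₁ (Measure.zero_le γ₂) (m₁' := 0) (m₂' := σ)
    (by rw [add_comm]) (by rw [add_comm]) (fun S hS => by rw [hd S hS, hd_zero])
    (fun S hS => by rw [hd S hS, hd_zero])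
  have h₂ := h.pairPayoff_exchange_le hc (Measure.zero_le γ₁) hle₂ (m₁' := σ) (m₂' := 0)
    (by rw [add_comm]) (by rw [add_comm]) (fun S hS => by rw [hd S hS, hd_zero])
    (fun S hS => by rw [hd S hS, hd_zero])
  simp only [pairPayoff, integral_zero_measure, zero_add, add_zero] at h₁ h₂
  exact le_antisymm h₂ h₁

theorem IsRelaxedOptimal.ae_left_eq_right (h : IsRelaxedOptimal c₁ c₂ μ ν γ₁ γ₂)
    (hc : IsAdmissiblePayoff c₁ c₂ μ ν) (hle₁ : σ ≤ γ₁) (hle₂ : σ ≤ γ₂)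
    (hdiag : ∀ᵐ p ∂σ, p.2 = p.1) : ∀ᵐ p ∂σ, c₁ p.1 = c₂ p.1 p.1 := by
  have hσ := h.hasSubmarginals_left hle₁
  have hae : (fun p => c₁ p.1) =ᵐ[σ] fun p => c₂ p.1 p.2 :=
    (hc.integrable_left hσ).ae_eq_of_forall_setIntegral_eq _ _ (hc.integrable_right hσ)
      fun A _ _ => h.integral_left_eq_right hc (Measure.restrict_le_self.trans hle₁)
        (Measure.restrict_le_self.trans hle₂)
        fun S _ => drift_eq_zero_of_ae_eq (ae_restrict_of_ae hdiag) S
  filter_upwards [hae, hdiag] with p hp hp'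
  rwa [hp'] at hp

end Diagonal

section OptimalPair

variable {c₁ : ℝ → ℝ} {c₂ : ℝ → ℝ → ℝ} {μ ν μ₁ μ₁' : Measure ℝ}

lemma isProbabilityMeasure_of_mem_martingaleTransports {π : Measure (ℝ × ℝ)}
    (h : π ∈ martingaleTransports μ ν) : IsProbabilityMeasure μ := by
  obtain ⟨⟨_, -⟩, rfl, -⟩ := h
  exact Measure.isProbabilityMeasure_map measurable_fst.aemeasurable

lemma compProd_condKernel_of_mem_martingaleTransports {π : Measure (ℝ × ℝ)} [IsFiniteMeasure π]
    (h : π ∈ martingaleTransports μ ν) : μ ⊗ₘ π.condKernel = π := by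
  obtain ⟨-, rfl, -⟩ := h
  exact π.disintegrate π.condKernel

lemma pairPayoff_le_relaxedValue {γ₁ γ₂ : Measure (ℝ × ℝ)} [IsProbabilityMeasure μ]
    (h₁ : IsMartingaleCoupling γ₁) (h₂ : IsMartingaleCoupling γ₂) (hfst : (γ₁ + γ₂).fst = μ)
    (hsnd : (γ₁ + γ₂).snd = ν) : (pairPayoff c₁ c₂ γ₁ γ₂ : EReal) ≤ relaxedValue c₁ c₂ μ ν := by
  have : IsProbabilityMeasure (γ₁ + γ₂) :=
    ⟨by rw [← Measure.fst_univ, hfst, measure_univ]⟩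
  have hadd : γ₁ + γ₂ ∈ martingaleTransports μ ν := by
    simpa only [hfst, hsnd] using (h₁.add h₂).mem_martingaleTransports
  exact le_iSup₂_of_le γ₁ γ₂ (le_iSup₂_of_le h₁.mem_finiteMartingaleTransports
    h₂.mem_finiteMartingaleTransports (le_iSup_of_le hadd le_rfl))

namespace IsOptimalPair

variable {π : ProbabilityMeasure (ℝ × ℝ)}

theorem isRelaxedOptimal (h : IsOptimalPair c₁ c₂ μ ν π μ₁)
    (hP : value c₁ c₂ μ ν = relaxedValue c₁ c₂ μ ν) :
    IsRelaxedOptimal c₁ c₂ μ ν (μ₁ ⊗ₘ (π : Measure (ℝ × ℝ)).condKernel)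
      ((μ - μ₁) ⊗ₘ (π : Measure (ℝ × ℝ)).condKernel) := by
  obtain ⟨hπ, hle, hval⟩ := h
  have := isProbabilityMeasure_of_mem_martingaleTransports hπ
  have := isFiniteMeasure_of_le μ hle
  have hdis := compProd_condKernel_of_mem_martingaleTransports hπ
  have hm : IsMartingaleCoupling (μ ⊗ₘ (π : Measure (ℝ × ℝ)).condKernel) := by
    rw [hdis]
    exact .of_mem_martingaleTransports hπ
  have hadd : μ₁ ⊗ₘ (π : Measure (ℝ × ℝ)).condKernel +
      (μ - μ₁) ⊗ₘ (π : Measure (ℝ × ℝ)).condKernel = π := by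
    rw [← Measure.compProd_add_left, add_comm, Measure.sub_add_cancel_of_le hle, hdis]
  refine ⟨hm.compProd_of_le hle, hm.compProd_of_le Measure.sub_le, ?_, ?_,
    fun γ₁ γ₂ h₁ h₂ hfst hsnd => ?_⟩
  · rw [hadd]
    exact hπ.2.1
  · rw [hadd]
    exact hπ.2.2.1
  · rw [← EReal.coe_le_coe_iff]
    exact (pairPayoff_le_relaxedValue h₁ h₂ hfst hsnd).trans (hval.trans hP).ge

theorem mutuallySingular [NullSingletonClass ν] (h : IsOptimalPair c₁ c₂ μ ν π μ₁)
    (hc : IsAdmissiblePayoff c₁ c₂ μ ν) (hconv : ∀ᵐ x ∂μ, StrictConvexOn ℝ Set.univ (c₂ x))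
    (hne : ∀ᵐ x ∂μ, c₁ x ≠ c₂ x x) (hP : value c₁ c₂ μ ν = relaxedValue c₁ c₂ μ ν) :
    μ₁ ⟂ₘ (μ - μ₁) := by
  have hopt := h.isRelaxedOptimal hP
  have := isProbabilityMeasure_of_mem_martingaleTransports h.1
  have := isFiniteMeasure_of_le μ h.2.1
  refine Measure.mutuallySingular_of_disjoint fun ρ hρ₁ hρ₂ => ?_
  have hρμ : ρ ≤ μ := hρ₁.trans h.2.1
  have := isFiniteMeasure_of_le μ hρμ
  have hle₁ := compProd_mono_left (κ := (π : Measure (ℝ × ℝ)).condKernel) hρ₁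
  have hle₂ := compProd_mono_left (κ := (π : Measure (ℝ × ℝ)).condKernel) hρ₂
  have hdiag := hopt.ae_snd_eq_fst hc ((hρμ Set.univ).trans_eq measure_univ) hle₁ hle₂
    (hopt.left.compProd_of_le hρ₁) (ae_mono hρμ hconv)
  have hbot : ∀ᵐ _ ∂(ρ ⊗ₘ (π : Measure (ℝ × ℝ)).condKernel), False := by
    filter_upwards [hopt.ae_left_eq_right hc hle₁ hle₂ hdiag,
      ae_compProd_fst_of_ae (ae_mono hρμ hne)] with p hp hp' using hp' hp
  rw [Filter.eventually_false_iff_eq_bot, ae_eq_bot] at hbot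
  rw [← Measure.fst_compProd ρ (π : Measure (ℝ × ℝ)).condKernel, hbot, Measure.fst_zero]
  exact bot_le

end IsOptimalPair

end OptimalPair

section Midpoint

variable {α : Type*} [MeasurableSpace α] {μ μ₁ μ₁' : Measure α} [IsFiniteMeasure μ₁]

lemma eq_restrict_compl_of_le {S : Set α} (h : μ₁ ≤ μ) (h₀ : μ₁ S = 0) (h₁ : (μ - μ₁) Sᶜ = 0) :
    μ₁ = μ.restrict Sᶜ := by
  calc μ₁ = μ₁.restrict Sᶜ :=
      (Measure.restrict_eq_self_of_ae_mem (measure_eq_zero_iff_ae_notMem.mp h₀)).symm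
    _ = (μ - μ₁).restrict Sᶜ + μ₁.restrict Sᶜ := by rw [Measure.restrict_eq_zero.mpr h₁, zero_add]
    _ = μ.restrict Sᶜ := by rw [← Measure.restrict_add, Measure.sub_add_cancel_of_le h]

variable [IsFiniteMeasure μ₁']

lemma half_smul_sub_add_half_smul (h : μ₁ ≤ μ) (h' : μ₁' ≤ μ) :
    (2⁻¹ : ℝ≥0∞) • ((μ - μ₁) + (μ - μ₁')) + (2⁻¹ : ℝ≥0∞) • (μ₁ + μ₁') = μ := by
  rw [← smul_add, add_add_add_comm, Measure.sub_add_cancel_of_le h,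
    Measure.sub_add_cancel_of_le h', smul_add, ← add_smul, ENNReal.inv_two_add_inv_two, one_smul]

lemma half_smul_add_le (h : μ₁ ≤ μ) (h' : μ₁' ≤ μ) : (2⁻¹ : ℝ≥0∞) • (μ₁ + μ₁') ≤ μ :=
  (Measure.le_add_left le_rfl).trans_eq (half_smul_sub_add_half_smul h h')

lemma sub_half_smul_add (h : μ₁ ≤ μ) (h' : μ₁' ≤ μ) :
    μ - (2⁻¹ : ℝ≥0∞) • (μ₁ + μ₁') = (2⁻¹ : ℝ≥0∞) • ((μ - μ₁) + (μ - μ₁')) := by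
  have : IsFiniteMeasure ((2⁻¹ : ℝ≥0∞) • (μ₁ + μ₁')) := Measure.smul_finite _ (by simp)
  conv_lhs => rw [← half_smul_sub_add_half_smul h h']
  exact Measure.add_sub_cancel

theorem eq_of_midpoint_mutuallySingular (h : μ₁ ≤ μ) (h' : μ₁' ≤ μ)
    (hs : (2⁻¹ : ℝ≥0∞) • (μ₁ + μ₁') ⟂ₘ (μ - (2⁻¹ : ℝ≥0∞) • (μ₁ + μ₁'))) : μ₁ = μ₁' := by
  rw [sub_half_smul_add h h'] at hs
  obtain ⟨S, -, h₀, h₁⟩ := hs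
  simp only [Measure.smul_apply, Measure.add_apply, smul_eq_mul, mul_eq_zero,
    ENNReal.inv_eq_zero, ENNReal.ofNat_ne_top, false_or, add_eq_zero] at h₀ h₁
  rw [eq_restrict_compl_of_le h h₀.1 h₁.1, eq_restrict_compl_of_le h' h₀.2 h₁.2]

end Midpoint

section Uniqueness

variable {c₁ : ℝ → ℝ} {c₂ : ℝ → ℝ → ℝ} {μ ν μ₁ μ₁' : Measure ℝ} {π : ProbabilityMeasure (ℝ × ℝ)}

lemma payoff_half_smul_add (hc : IsAdmissiblePayoff c₁ c₂ μ ν)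
    (hπ : (π : Measure (ℝ × ℝ)) ∈ martingaleTransports μ ν) (h : μ₁ ≤ μ) (h' : μ₁' ≤ μ) :
    payoff c₁ c₂ μ π ((2⁻¹ : ℝ≥0∞) • (μ₁ + μ₁')) =
      2⁻¹ * (payoff c₁ c₂ μ π μ₁ + payoff c₁ c₂ μ π μ₁') := by
  have := isProbabilityMeasure_of_mem_martingaleTransports hπ
  have := isFiniteMeasure_of_le μ h
  have := isFiniteMeasure_of_le μ h'
  have hsub {τ : Measure ℝ} (hτ : τ ≤ μ) :
      HasSubmarginals (τ ⊗ₘ (π : Measure (ℝ × ℝ)).condKernel) μ ν := by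
    have := isFiniteMeasure_of_le μ hτ
    have hle := (compProd_mono_left (κ := (π : Measure (ℝ × ℝ)).condKernel) hτ).trans_eq
      (compProd_condKernel_of_mem_martingaleTransports hπ)
    exact HasSubmarginals.mono ⟨hπ.2.1.le, hπ.2.2.1.le⟩ hle
  simp only [payoff, sub_half_smul_add h h', Measure.compProd_smul_left,
    Measure.compProd_add_left, pairPayoff_smul, ENNReal.toReal_inv, ENNReal.toReal_ofNat]
  rw [hc.pairPayoff_add (hsub h) (hsub Measure.sub_le) (hsub h') (hsub Measure.sub_le)]

namespace IsOptimalPair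

lemma midpoint (h : IsOptimalPair c₁ c₂ μ ν π μ₁) (h' : IsOptimalPair c₁ c₂ μ ν π μ₁')
    (hc : IsAdmissiblePayoff c₁ c₂ μ ν) :
    IsOptimalPair c₁ c₂ μ ν π ((2⁻¹ : ℝ≥0∞) • (μ₁ + μ₁')) := by
  have := isProbabilityMeasure_of_mem_martingaleTransports h.1
  have := isFiniteMeasure_of_le μ h.2.1
  have := isFiniteMeasure_of_le μ h'.2.1
  have heq : payoff c₁ c₂ μ π μ₁ = payoff c₁ c₂ μ π μ₁' :=
    EReal.coe_injective (h.2.2.trans h'.2.2.symm)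
  refine ⟨h.1, half_smul_add_le h.2.1 h'.2.1, ?_⟩
  rw [payoff_half_smul_add hc h.1 h.2.1 h'.2.1, ← heq, ← two_mul,
    inv_mul_cancel_left₀ two_ne_zero]
  exact h.2.2

theorem unique [NullSingletonClass ν] (h : IsOptimalPair c₁ c₂ μ ν π μ₁)
    (h' : IsOptimalPair c₁ c₂ μ ν π μ₁') (hc : IsAdmissiblePayoff c₁ c₂ μ ν)
    (hconv : ∀ᵐ x ∂μ, StrictConvexOn ℝ Set.univ (c₂ x)) (hne : ∀ᵐ x ∂μ, c₁ x ≠ c₂ x x)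
    (hP : value c₁ c₂ μ ν = relaxedValue c₁ c₂ μ ν) : μ₁ = μ₁' := by
  have := isProbabilityMeasure_of_mem_martingaleTransports h.1
  have := isFiniteMeasure_of_le μ h.2.1
  have := isFiniteMeasure_of_le μ h'.2.1
  exact eq_of_midpoint_mutuallySingular h.2.1 h'.2.1
    ((h.midpoint h' hc).mutuallySingular hc hconv hne hP)

end IsOptimalPair

end Uniqueness

end AmericanOption

theorem mainTheorem1_general {μ ν : Measure ℝ} [NullSingletonClass ν] {c₁ : ℝ → ℝ}
    {c₂ : ℝ → ℝ → ℝ} (hc₁ : Measurable c₁) (hc₂ : Measurable fun p : ℝ × ℝ => c₂ p.1 p.2)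
    (hA : ∃ v w : ℝ → ℝ, Integrable v μ ∧ Integrable w ν ∧
      ∀ x y : ℝ, |c₁ x| + |c₂ x y| ≤ v x + w y)
    (hconv : ∀ᵐ x ∂μ, StrictConvexOn ℝ Set.univ (c₂ x))
    (hne : ∀ᵐ x ∂μ, c₁ x ≠ c₂ x x)
    (hP : AmericanOption.value c₁ c₂ μ ν = AmericanOption.relaxedValue c₁ c₂ μ ν) :
    (∀ (π : ProbabilityMeasure (ℝ × ℝ)) (μ₁ : Measure ℝ),
      AmericanOption.IsOptimalPair c₁ c₂ μ ν π μ₁ → μ₁ ⟂ₘ (μ - μ₁)) ∧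
    (∀ (π : ProbabilityMeasure (ℝ × ℝ)) (μ₁ μ₁' : Measure ℝ),
      AmericanOption.IsOptimalPair c₁ c₂ μ ν π μ₁ →
      AmericanOption.IsOptimalPair c₁ c₂ μ ν π μ₁' → μ₁ = μ₁') :=
  have hc : AmericanOption.IsAdmissiblePayoff c₁ c₂ μ ν := ⟨hc₁, hc₂, hA⟩
  ⟨fun _ _ h => h.mutuallySingular hc hconv hne hP,
    fun _ _ _ h h' => h.unique h' hc hconv hne hP⟩

theorem mainTheorem1 (μ ν : Measure ℝ)
    (hμ : AmericanOption.FiniteMomentProb μ) (hν : AmericanOption.FiniteMomentProb ν)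
    (hμν : AmericanOption.ConvexOrder μ ν)
    (c₁ : ℝ → ℝ) (c₂ : ℝ → ℝ → ℝ)
    (hc₁ : Continuous c₁) (hc₂ : Continuous (fun p : ℝ × ℝ => c₂ p.1 p.2))
    (hA : ∃ v w : ℝ → ℝ, Continuous v ∧ Continuous w ∧ Integrable v μ ∧ Integrable w ν ∧
      ∀ x y : ℝ, |c₁ x| + |c₂ x y| ≤ v x + w y)
    (hconv : ∀ᵐ x ∂μ, StrictConvexOn ℝ Set.univ (c₂ x))
    (hne : ∀ᵐ x ∂μ, c₁ x ≠ c₂ x x)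
    (hac : ν ≪ volume)
    (hP : AmericanOption.value c₁ c₂ μ ν = AmericanOption.relaxedValue c₁ c₂ μ ν) :
    (∀ (π : ProbabilityMeasure (ℝ × ℝ)) (μ₁ : Measure ℝ),
      AmericanOption.IsOptimalPair c₁ c₂ μ ν π μ₁ → μ₁ ⟂ₘ (μ - μ₁)) ∧
    (∀ (π : ProbabilityMeasure (ℝ × ℝ)) (μ₁ μ₁' : Measure ℝ),
      AmericanOption.IsOptimalPair c₁ c₂ μ ν π μ₁ →
      AmericanOption.IsOptimalPair c₁ c₂ μ ν π μ₁' → μ₁ = μ₁') :=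
  have : NullSingletonClass ν := ⟨fun x => hac (measure_singleton x)⟩
  mainTheorem1_general hc₁.measurable hc₂.measurable
    (hA.imp fun _ ⟨w, _, _, hvw⟩ => ⟨w, hvw⟩) hconv hne hP
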